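/- For every real $p\ge 2$ there is a constant $C(p)>0$, depending only on $p$, with the following property. Let $N,d\ge 1$ be integers, let $\tilde A\in\mathbb R^{Nd\times Nd}\setminus\{0\}$ be a symmetric nonnegative definite matrix, with trace $\mathrm{Tr}\,\tilde A$ and spectral norm (largest eigenvalue) $\rho(\tilde A)$, and let $\varepsilon_1,\dots,\varepsilon_N$ be i.i.d. random vectors in $\mathbb R^d$ with $\mathbb E\varepsilon_1=0$, $\mathbb E\|\varepsilon_1\|^p<\infty$ ($\|\cdot\|$ the Euclidean norm) and covariance matrix $\Phi$. Write $\varepsilon=(\varepsilon_1^T,\dots,\varepsilon_N^T)^T\in\mathbb R^{Nd}$, let $\delta\ge 0$ be defined by $$\delta^2\,\mathrm{Tr}\,\tilde A=\mathrm{Tr}\big(\tilde A\,(I_N\otimes\Phi)\big),$$ and assume $\delta>0$. Then for all $x>0$ $$\mathbb P\Big(\varepsilon^T\tilde A\varepsilon\ \ge\ \delta^2\,\mathrm{Tr}\,\tilde A+2\delta^2\sqrt{\mathrm{Tr}(\tilde A)\,\rho(\tilde A)\,x}+\delta^2\rho(\tilde A)\,x\Big)\ \le\ C(p)\,\frac{\mathbb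 E\|\varepsilon_1\|^p\;\mathrm{Tr}\,\tilde A}{\delta^p\,\rho(\tilde A)\,x^{p/2}},$$ and also $$\mathbb P\Big(\varepsilon^T\tilde A\varepsilon\ \ge\ \delta^2\,\mathrm{Tr}\,\tilde A+2\delta^2\sqrt{\mathrm{Tr}(\tilde A)\,\delta\,x}+\delta^2\,\mathrm{Tr}(\tilde A)\,x\Big)\ \le\ C(p)\,\frac{\mathbb E\|\varepsilon_1\|^p\;\mathrm{Tr}\,\tilde A}{\delta^p\,\rho(\tilde A)\,x^{p/2}}.$$ -/

import Mathlib

open MeasureTheory ProbabilityTheory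
open scoped Kronecker Matrix

noncomputable section

/-- The covariance matrix `V(X)` of a random vector `X` in `ℝ^d`, with entries `Cov(X_j, X_k)`. -/
def covarMat {Ω : Type*} [MeasurableSpace Ω] (μ : Measure Ω) {d : ℕ}
    (X : Ω → EuclideanSpace ℝ (Fin d)) : Matrix (Fin d) (Fin d) ℝ :=
  Matrix.of fun j k => cov[fun ω => X ω j, fun ω => X ω k; μ]

/-- The vector of `ℝ^{Nd}` obtained by stacking `v_1, …, v_N ∈ ℝ^d`. The coordinates of `ℝ^{Nd}`
are indexed by pairs (block, position in the block), as in the Kronecker product of an `N × N`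
and a `d × d` matrix. -/
def stackVec {N d : ℕ} (v : Fin N → EuclideanSpace ℝ (Fin d)) : Fin N × Fin d → ℝ :=
  fun q => v q.1 q.2

/-- The spectral norm `sup_{x ≠ 0} ‖M x‖ / ‖x‖` of a real square matrix `M`, for the Euclidean
norm; it is the largest eigenvalue if `M` is nonnegative definite. -/
def specNorm {n : Type*} [Fintype n] [DecidableEq n] (M : Matrix n n ℝ) : ℝ :=
  ‖Matrix.toEuclideanCLM (𝕜 := ℝ) M‖

end

/-!
Tail bounds for `εᵀ A ε` with `ε` made of i.i.d. centered blocks, under a `p`-th moment condition.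

Write `A = BᵀB`, so that `εᵀ A ε = ‖B ε‖²`, and let `ρ = ‖A‖`, `T = Tr A`, `M = 𝔼 ‖ε₁‖ ^ p`. The
threshold `δ²T + 2δ²√(Tρx) + δ²ρx` is the square of `δ√T + δ√(ρx)`, and
`𝔼 ‖B ε‖ ≤ √(𝔼 ‖B ε‖²) = δ√T`. So a bound is needed for the deviation of `‖B ε‖` above its mean,
and by Markov's and Jensen's inequalities it suffices to show
`𝔼 |‖B ε‖ - ‖B ε'‖| ^ p ≤ C ρ ^ (p/2 - 1) T M` for an independent copy `ε'` of `ε`.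

By `abs_norm_sub_norm_le_abs_inner`, the difference is at most `|⟪u, B (ε - ε')⟫|`, where `u` is the
direction of `B (ε + ε')`. Exchanging `ε_i` and `ε'_i` for some of the indices `i` changes neither
`u` nor the joint law, and only flips signs in `⟪u, B (ε - ε')⟫ = ∑ i, ⟪(Bᵀu)_i, ε_i - ε'_i⟫`.
Averaging over all exchanges, Khintchine's inequality (`sum_signs_abs_rpow_le`) leaves
`(∑ i, ‖(Bᵀu)_i‖² ‖ε_i - ε'_i‖²) ^ (p/2)`. The weights `‖(Bᵀu)_i‖²` have sum at most `ρ` and are each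
at most the trace `a i` of the `i`-th diagonal block of `A`, so Jensen's inequality
(`rpow_sum_mul_le`) bounds this by `ρ ^ (p/2 - 1) ∑ i, a i ‖ε_i - ε'_i‖ ^ p`, where `∑ i, a i = T`
(`sum_swapCoords_abs_norm_sub_rpow_le`, `integral_abs_norm_sub_rpow_le`).

For the second threshold the term `δ²Tx` is enough. If `Tx ≥ ρ`, it exceeds
`2δ²√(Tρx/6) + δ²ρx/6`, and the first argument applies with `x/6` in place of `x`. If `Tx ≤ ρ`, then
`x ≤ 1`, and since `δ² ≤ 𝔼 ‖ε₁‖²` (`trace_mul_one_kronecker_covarMat_le`) the right side is at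
least `1`.
-/

/-! ### Khintchine's inequality and two elementary estimates -/

theorem Real.rpow_le_rpow_mul_exp {p x : ℝ} (hp : 0 < p) (hx : 0 ≤ x) :
    x ^ p ≤ p ^ p * Real.exp x := by
  have h1 : x ≤ p * Real.exp (x / p) := by
    have := Real.add_one_le_exp (x / p)
    calc x = p * (x / p) := by field_simp
      _ ≤ p * Real.exp (x / p) := by gcongr; linarith
  calc x ^ p ≤ (p * Real.exp (x / p)) ^ p := Real.rpow_le_rpow hx h1 hp.le
    _ = p ^ p * Real.exp x := by
      rw [Real.mul_rpow hp.le (Real.exp_pos _).le, ← Real.exp_mul, div_mul_cancel₀ _ hp.ne']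

/-- Exponential moment of a Rademacher sum, as a sum over all sign patterns: the left side is
`∏ i, 2 * cosh (c i)`, and `cosh y ≤ exp (y ^ 2 / 2)`. -/
theorem sum_signs_exp_le {ι : Type*} [Fintype ι] [DecidableEq ι] (c : ι → ℝ) :
    ∑ s : ι → Bool, Real.exp (∑ i, if s i then -c i else c i)
      ≤ 2 ^ Fintype.card ι * Real.exp ((∑ i, c i ^ 2) / 2) := by
  have h : ∑ s : ι → Bool, Real.exp (∑ i, if s i then -c i else c i)
      = ∏ i, ∑ b : Bool, Real.exp (if b then -c i else c i) := by
    rw [Finset.prod_univ_sum, Fintype.piFinset_univ]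
    exact Finset.sum_congr rfl fun s _ => Real.exp_sum _ _
  rw [h, Finset.sum_div, Real.exp_sum, ← Finset.card_univ, ← Finset.prod_const,
    ← Finset.prod_mul_distrib]
  refine Finset.prod_le_prod (fun i _ => by positivity) fun i _ => ?_
  have h1 := Real.cosh_le_exp_half_sq (c i)
  rw [Real.cosh_eq] at h1
  simp
  linarith

/-- Khintchine's inequality for a real exponent, with the average over the signs written as a finite
sum. After normalising `∑ c i ^ 2 = 1` it follows from the exponential moment and
`|X| ^ p ≤ p ^ p * (exp X + exp (-X))`. -/
theorem sum_signs_abs_rpow_le {ι : Type*} [Fintype ι] [DecidableEq ι] {p : ℝ} (hp : 0 < p)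
    (c : ι → ℝ) :
    ∑ s : ι → Bool, |∑ i, if s i then -c i else c i| ^ p
      ≤ 2 ^ Fintype.card ι * (2 * Real.exp (1 / 2) * p ^ p) * (∑ i, c i ^ 2) ^ (p / 2) := by
  rcases (Finset.sum_nonneg fun i (_ : i ∈ Finset.univ) => sq_nonneg (c i)).eq_or_lt with h0 | h0
  · have hc : c = 0 := by
      funext i
      have := (Finset.sum_eq_zero_iff_of_nonneg
        fun i (_ : i ∈ Finset.univ) => sq_nonneg (c i)).1 h0.symm i (Finset.mem_univ i)
      simpa using this
    simp [hc, Real.zero_rpow hp.ne']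
    positivity
  set v := ∑ i, c i ^ 2
  set r := √v
  have hr : 0 < r := Real.sqrt_pos.2 h0
  have hrp : r ^ p = v ^ (p / 2) := by
    rw [show r = v ^ (1 / 2 : ℝ) from Real.sqrt_eq_rpow v, ← Real.rpow_mul h0.le]; congr 1; ring
  have hnorm : ∑ i, (c i / r) ^ 2 = 1 := by
    simp_rw [div_pow]
    rw [← Finset.sum_div, Real.sq_sqrt h0.le, div_self h0.ne']
  have hterm (s : ι → Bool) : |∑ i, if s i then -c i else c i| ^ p ≤ r ^ p * (p ^ p *
      (Real.exp (∑ i, if s i then -(c i / r) else c i / r)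
        + Real.exp (∑ i, if s i then -(-(c i / r)) else -(c i / r)))) := by
    set X := ∑ i, if s i then -c i else c i
    have e1 : (∑ i, if s i then -(c i / r) else c i / r) = X / r := by
      rw [Finset.sum_div]; refine Finset.sum_congr rfl fun i _ => ?_; split_ifs <;> ring
    have e2 : (∑ i, if s i then -(-(c i / r)) else -(c i / r)) = -(X / r) := by
      rw [Finset.sum_div, ← Finset.sum_neg_distrib]
      refine Finset.sum_congr rfl fun i _ => ?_; split_ifs <;> ring
    rw [e1, e2]
    have : |X| = r * |X / r| := by rw [abs_div, abs_of_pos hr]; field_simp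
    rw [this, Real.mul_rpow hr.le (abs_nonneg _)]
    gcongr
    refine (Real.rpow_le_rpow_mul_exp hp (abs_nonneg _)).trans ?_
    gcongr
    exact Real.exp_abs_le _
  refine (Finset.sum_le_sum fun s _ => hterm s).trans ?_
  rw [← Finset.mul_sum, ← Finset.mul_sum, Finset.sum_add_distrib]
  have h1 := sum_signs_exp_le fun i => c i / r
  have h2 := sum_signs_exp_le fun i => -(c i / r)
  simp only [neg_sq, hnorm] at h1 h2
  rw [hrp]
  calc _ ≤ v ^ (p / 2) * (p ^ p * (2 ^ Fintype.card ι * Real.exp (1 / 2)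
          + 2 ^ Fintype.card ι * Real.exp (1 / 2))) := by gcongr
    _ = _ := by ring

/-- Jensen's inequality for the weights `w`, whose total mass is at most `ρ` and which are dominated
coordinatewise by `a`. The bound no longer depends on `w`; this is what turns the supremum over
unit vectors in the weak variance into a sum of `p`-th moments, without loss in `ρ`. -/
theorem rpow_sum_mul_le {ι : Type*} [Fintype ι] {q ρ : ℝ} (hq : 1 ≤ q) {w a h : ι → ℝ}
    (hw : ∀ i, 0 ≤ w i) (hwa : ∀ i, w i ≤ a i) (hwρ : ∑ i, w i ≤ ρ) (hh : ∀ i, 0 ≤ h i) :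
    (∑ i, w i * h i) ^ q ≤ ρ ^ (q - 1) * ∑ i, a i * h i ^ q := by
  have h0 : 0 ≤ ∑ i, w i := Finset.sum_nonneg fun i _ => hw i
  have hR : 0 ≤ ∑ i, w i * h i ^ q :=
    Finset.sum_nonneg fun i _ => mul_nonneg (hw i) (Real.rpow_nonneg (hh i) _)
  have h1 := Real.inner_le_weight_mul_Lp_of_nonneg Finset.univ hq w h hw hh
  calc (∑ i, w i * h i) ^ q
      ≤ ((∑ i, w i) ^ (1 - q⁻¹) * (∑ i, w i * h i ^ q) ^ q⁻¹) ^ q :=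
        Real.rpow_le_rpow (Finset.sum_nonneg fun i _ => mul_nonneg (hw i) (hh i)) h1 (by linarith)
    _ = (∑ i, w i) ^ (q - 1) * ∑ i, w i * h i ^ q := by
        have hq0 : q ≠ 0 := by linarith
        rw [Real.mul_rpow (Real.rpow_nonneg h0 _) (Real.rpow_nonneg hR _), ← Real.rpow_mul h0,
          Real.rpow_inv_rpow hR hq0, sub_mul, inv_mul_cancel₀ hq0, one_mul]
    _ ≤ ρ ^ (q - 1) * ∑ i, a i * h i ^ q := by
        refine mul_le_mul (Real.rpow_le_rpow h0 hwρ (by linarith))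
          (Finset.sum_le_sum fun i _ => mul_le_mul_of_nonneg_right (hwa i)
            (Real.rpow_nonneg (hh i) _)) hR (Real.rpow_nonneg (h0.trans hwρ) _)

/-- The difference of two norms in an inner product space is at most the component of `x - y` along
the direction of `x + y`, as `‖x‖ ^ 2 - ‖y‖ ^ 2 = ⟪x + y, x - y⟫` and `‖x + y‖ ≤ ‖x‖ + ‖y‖`. The
point is that this direction depends only on `x + y`. When `x + y = 0` it is `0` by the convention
`0⁻¹ = 0`, and both sides vanish. -/
theorem abs_norm_sub_norm_le_abs_inner {H : Type*} [NormedAddCommGroup H]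
    [InnerProductSpace ℝ H] (x y : H) :
    |‖x‖ - ‖y‖| ≤ |inner ℝ (‖x + y‖⁻¹ • (x + y)) (x - y)| := by
  rcases eq_or_ne (x + y) 0 with h | h
  · rw [eq_neg_of_add_eq_zero_left h]; simp
  have hpos : 0 < ‖x + y‖ := norm_pos_iff.2 h
  have e : inner ℝ (x + y) (x - y) = (‖x‖ - ‖y‖) * (‖x‖ + ‖y‖) := by
    rw [inner_add_left, inner_sub_right, inner_sub_right, real_inner_self_eq_norm_sq,
      real_inner_self_eq_norm_sq, real_inner_comm x y]
    ring
  rw [real_inner_smul_left, e, abs_mul, abs_mul, abs_of_pos (inv_pos.2 hpos),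
    abs_of_nonneg (by positivity : 0 ≤ ‖x‖ + ‖y‖), inv_mul_eq_div, le_div_iff₀ hpos]
  gcongr
  exact norm_add_le x y

/-! ### Symmetrization by coordinate swaps -/

/-- Exchange the two components of `z i` for the indices `i` with `s i = true`. Applied to a sample
paired with an independent copy of it, this preserves the joint law. -/
def swapCoords {ι E : Type*} (s : ι → Bool) (z : ι → E × E) : ι → E × E :=
  fun i => if s i then (z i).swap else z i

/-- The symmetrization estimate, for a fixed pair of samples. Here `W` is the blockwise adjoint of `G`,
`a i` bounds the squared norm of the `i`-th block of `G` and `ρ` that of `G`. The direction `u` of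
`G (x + y)` is unchanged by coordinate swaps, while each `⟪W u i, x i - y i⟫` only changes its
sign, so Khintchine's inequality bounds the sum over all swaps by a power of
`∑ i, ‖W u i‖ ^ 2 * ‖x i - y i‖ ^ 2`. -/
theorem sum_swapCoords_abs_norm_sub_rpow_le {ι E H : Type*} [Fintype ι] [DecidableEq ι]
    [NormedAddCommGroup E] [InnerProductSpace ℝ E] [NormedAddCommGroup H] [InnerProductSpace ℝ H]
    (G : (ι → E) →L[ℝ] H) (W : H → ι → E) {a : ι → ℝ} {ρ p : ℝ} (hp : 2 ≤ p)
    (hGW : ∀ u v, inner ℝ u (G v) = ∑ i, inner ℝ (W u i) (v i))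
    (ha : ∀ u i, ‖W u i‖ ^ 2 ≤ a i * ‖u‖ ^ 2) (hρ : ∀ u, ∑ i, ‖W u i‖ ^ 2 ≤ ρ * ‖u‖ ^ 2)
    (ha0 : ∀ i, 0 ≤ a i) (hρ0 : 0 ≤ ρ)
    (z : ι → E × E) :
    ∑ s : ι → Bool, |‖G fun i => (swapCoords s z i).1‖ - ‖G fun i => (swapCoords s z i).2‖| ^ p
      ≤ 2 ^ Fintype.card ι * (2 * Real.exp (1 / 2) * p ^ p) *
        (ρ ^ (p / 2 - 1) * ∑ i, a i * ‖(z i).1 - (z i).2‖ ^ p) := by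
  have hp0 : 0 < p := by linarith
  -- `b` and the direction `u` are symmetric in the two components of `z`.
  set b := G fun i => (z i).1 + (z i).2
  set u := ‖b‖⁻¹ • b
  have hu : ‖u‖ ^ 2 ≤ 1 := by
    have : ‖u‖ ≤ 1 := by
      rw [norm_smul, norm_inv, norm_norm]; exact inv_mul_le_one
    exact pow_le_one₀ (norm_nonneg _) this
  set c : ι → ℝ := fun i => inner ℝ (W u i) ((z i).1 - (z i).2)
  have hterm (s : ι → Bool) :
      |‖G fun i => (swapCoords s z i).1‖ - ‖G fun i => (swapCoords s z i).2‖|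
        ≤ |∑ i, if s i then -c i else c i| := by
    refine (abs_norm_sub_norm_le_abs_inner _ _).trans_eq ?_
    have e1 : (G fun i => (swapCoords s z i).1) + (G fun i => (swapCoords s z i).2) = b := by
      rw [← map_add]; congr 1; ext i
      by_cases h : s i <;> simp [swapCoords, h, add_comm]
    rw [e1, ← map_sub, hGW]
    congr 1
    refine Finset.sum_congr rfl fun i _ => ?_
    by_cases h : s i
    · simp only [swapCoords, h, Pi.sub_apply, if_true, Prod.fst_swap, Prod.snd_swap, c]
      rw [← inner_neg_right, neg_sub]
    · simp [swapCoords, h, c, u]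
  have hsq : ∑ i, c i ^ 2 ≤ ∑ i, ‖W u i‖ ^ 2 * ‖(z i).1 - (z i).2‖ ^ 2 := by
    refine Finset.sum_le_sum fun i _ => ?_
    rw [← mul_pow, ← sq_abs (c i)]
    exact pow_le_pow_left₀ (abs_nonneg _) (abs_real_inner_le_norm _ _) 2
  calc _ ≤ ∑ s : ι → Bool, |∑ i, if s i then -c i else c i| ^ p :=
        Finset.sum_le_sum fun s _ => Real.rpow_le_rpow (abs_nonneg _) (hterm s) hp0.le
    _ ≤ _ := sum_signs_abs_rpow_le hp0 c
    _ ≤ _ := by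
      refine mul_le_mul_of_nonneg_left ?_ (by positivity)
      refine (Real.rpow_le_rpow (by positivity) hsq (by positivity)).trans ?_
      refine (rpow_sum_mul_le (a := a) (ρ := ρ) (by linarith) (fun i => by positivity)
        (fun i => (ha u i).trans (mul_le_of_le_one_right (ha0 i) hu))
        ((hρ u).trans (mul_le_of_le_one_right hρ0 hu)) (fun i => by positivity)).trans_eq ?_
      congr 1
      refine Finset.sum_congr rfl fun i _ => ?_
      rw [← Real.rpow_natCast, ← Real.rpow_mul (norm_nonneg _)]
      congr 2; push_cast; ring

theorem measurePreserving_swapCoords {ι E : Type*} [Fintype ι] [MeasurableSpace E]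
    (ν : Measure E) [IsProbabilityMeasure ν] (s : ι → Bool) :
    MeasurePreserving (swapCoords s) (Measure.pi fun _ : ι => ν.prod ν)
      (Measure.pi fun _ : ι => ν.prod ν) := by
  refine measurePreserving_pi (fun _ => ν.prod ν) (fun _ => ν.prod ν)
    (f := fun i x => if s i then x.swap else x) fun i => ?_
  by_cases h : s i
  · simpa [h] using Measure.measurePreserving_swap (μ := ν) (ν := ν)
  · simpa [h] using! MeasurePreserving.id (ν.prod ν)

theorem norm_sub_rpow_le {E : Type*} [SeminormedAddCommGroup E] {p : ℝ} (hp : 1 ≤ p) (x y : E) :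
    ‖x - y‖ ^ p ≤ 2 ^ (p - 1) * (‖x‖ ^ p + ‖y‖ ^ p) :=
  (Real.rpow_le_rpow (norm_nonneg _) (norm_sub_le x y) (by linarith)).trans
    (mod_cast NNReal.rpow_add_le_mul_rpow_add_rpow ‖x‖₊ ‖y‖₊ hp)

theorem integrable_norm_sub_rpow {E : Type*} [NormedAddCommGroup E]
    [MeasurableSpace E] [BorelSpace E] [SecondCountableTopology E] {ν : Measure E}
    [IsProbabilityMeasure ν] {p : ℝ} (hp : 1 ≤ p) (hν : Integrable (fun x => ‖x‖ ^ p) ν) :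
    Integrable (fun y : E × E => ‖y.1 - y.2‖ ^ p) (ν.prod ν) := by
  refine (((hν.comp_fst ν).add (hν.comp_snd ν)).const_mul (2 ^ (p - 1))).mono'
    (Measurable.aestronglyMeasurable (by fun_prop)) (ae_of_all _ fun y => ?_)
  rw [Real.norm_of_nonneg (by positivity)]
  exact norm_sub_rpow_le hp _ _

theorem integral_norm_sub_rpow_le {E : Type*} [NormedAddCommGroup E]
    [MeasurableSpace E] [BorelSpace E] [SecondCountableTopology E] {ν : Measure E}
    [IsProbabilityMeasure ν] {p : ℝ} (hp : 1 ≤ p) (hν : Integrable (fun x => ‖x‖ ^ p) ν) :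
    ∫ y : E × E, ‖y.1 - y.2‖ ^ p ∂(ν.prod ν) ≤ 2 ^ p * ∫ x, ‖x‖ ^ p ∂ν := by
  have h1 := hν.comp_fst ν
  have h2 := hν.comp_snd ν
  calc _ ≤ ∫ y : E × E, 2 ^ (p - 1) * (‖y.1‖ ^ p + ‖y.2‖ ^ p) ∂(ν.prod ν) :=
        integral_mono (integrable_norm_sub_rpow hp hν) ((h1.add h2).const_mul _)
          fun y => norm_sub_rpow_le hp _ _
    _ = 2 ^ (p - 1) * (2 * ∫ x, ‖x‖ ^ p ∂ν) := by
        rw [integral_const_mul, integral_add h1 h2, integral_fun_fst (fun x : E => ‖x‖ ^ p),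
          integral_fun_snd (fun x : E => ‖x‖ ^ p)]
        simp only [probReal_univ, one_smul, two_mul]
    _ = _ := by
        rw [Real.rpow_sub_one two_ne_zero]; ring

/-- The `p`-th moment of `‖G X‖ - ‖G X'‖` for independent vectors `X`, `X'` with i.i.d. blocks of law
`ν`: the pointwise symmetrization estimate integrated over the swap-invariant joint law. -/
theorem integral_abs_norm_sub_rpow_le {ι E H : Type*} [Fintype ι] [DecidableEq ι]
    [NormedAddCommGroup E] [InnerProductSpace ℝ E] [NormedAddCommGroup H] [InnerProductSpace ℝ H]
    [MeasurableSpace E] [BorelSpace E] [SecondCountableTopology E]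
    (G : (ι → E) →L[ℝ] H) (W : H → ι → E) {a : ι → ℝ} {ρ p : ℝ} (hp : 2 ≤ p)
    (hGW : ∀ u v, inner ℝ u (G v) = ∑ i, inner ℝ (W u i) (v i))
    (ha : ∀ u i, ‖W u i‖ ^ 2 ≤ a i * ‖u‖ ^ 2) (hρ : ∀ u, ∑ i, ‖W u i‖ ^ 2 ≤ ρ * ‖u‖ ^ 2)
    (ha0 : ∀ i, 0 ≤ a i) (hρ0 : 0 ≤ ρ) (ν : Measure E) [IsProbabilityMeasure ν]
    (hν : Integrable (fun x => ‖x‖ ^ p) ν) :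
    Integrable (fun z : (ι → E) × (ι → E) => |‖G z.1‖ - ‖G z.2‖| ^ p)
      ((Measure.pi fun _ => ν).prod (Measure.pi fun _ => ν)) ∧
    ∫ z : (ι → E) × (ι → E), |‖G z.1‖ - ‖G z.2‖| ^ p
      ∂((Measure.pi fun _ => ν).prod (Measure.pi fun _ => ν))
      ≤ 2 * Real.exp (1 / 2) * p ^ p * 2 ^ p *
        (ρ ^ (p / 2 - 1) * (∑ i, a i) * ∫ x, ‖x‖ ^ p ∂ν) := by
  set e := MeasurableEquiv.arrowProdEquivProdArrow E E ι
  have he : MeasurePreserving e (Measure.pi fun _ : ι => ν.prod ν)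
      ((Measure.pi fun _ => ν).prod (Measure.pi fun _ => ν)) :=
    measurePreserving_arrowProdEquivProdArrow E E ι (fun _ => ν) (fun _ => ν)
  rw [← he.integrable_comp_emb e.measurableEmbedding, ← he.integral_comp' (f := e)]
  set F : (ι → E × E) → ℝ := fun z => |‖G fun i => (z i).1‖ - ‖G fun i => (z i).2‖| ^ p
  have hFm : Measurable F := by
    have : Continuous fun z : ι → E × E =>
      |‖G fun i => (z i).1‖ - ‖G fun i => (z i).2‖| := by fun_prop
    exact this.measurable.pow_const p
  have hF0 z : 0 ≤ F z := Real.rpow_nonneg (abs_nonneg _) _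
  set K := 2 * Real.exp (1 / 2) * p ^ p
  set R : (ι → E × E) → ℝ := fun z =>
    2 ^ Fintype.card ι * K * (ρ ^ (p / 2 - 1) * ∑ i, a i * ‖(z i).1 - (z i).2‖ ^ p)
  have hpt z : ∑ s : ι → Bool, F (swapCoords s z) ≤ R z :=
    sum_swapCoords_abs_norm_sub_rpow_le G W hp hGW ha hρ ha0 hρ0 z
  have hη (i : ι) : Integrable (fun z : ι → E × E => ‖(z i).1 - (z i).2‖ ^ p)
      (Measure.pi fun _ : ι => ν.prod ν) :=
    (measurePreserving_eval (fun _ : ι => ν.prod ν) i).integrable_comp_of_integrable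
      (integrable_norm_sub_rpow (by linarith) hν)
  have hηi (i : ι) : ∫ z : ι → E × E, ‖(z i).1 - (z i).2‖ ^ p
      ∂(Measure.pi fun _ : ι => ν.prod ν) ≤ 2 ^ p * ∫ x, ‖x‖ ^ p ∂ν := by
    refine (integral_comp_eval (μ := fun _ : ι => ν.prod ν) (i := i)
      (f := fun y : E × E => ‖y.1 - y.2‖ ^ p)
      (Measurable.aestronglyMeasurable (by fun_prop))).trans_le ?_
    exact integral_norm_sub_rpow_le (by linarith) hν
  have hR : Integrable R (Measure.pi fun _ : ι => ν.prod ν) :=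
    ((integrable_finsetSum _ fun i _ => (hη i).const_mul (a i)).const_mul _).const_mul _
  have hFi : Integrable F (Measure.pi fun _ : ι => ν.prod ν) := by
    refine hR.mono' hFm.aestronglyMeasurable (ae_of_all _ fun z => ?_)
    rw [Real.norm_of_nonneg (hF0 z)]
    -- The pattern without swaps is one of the terms of the sum.
    refine le_trans ?_ (hpt z)
    have := Finset.single_le_sum (f := fun s : ι → Bool => F (swapCoords s z))
      (fun s _ => hF0 _) (Finset.mem_univ (fun _ => false))
    exact this
  refine ⟨hFi, ?_⟩
  have hs (s : ι → Bool) : ∫ z, F (swapCoords s z) ∂(Measure.pi fun _ : ι => ν.prod ν)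
      = ∫ z, F z ∂(Measure.pi fun _ : ι => ν.prod ν) := by
    have hmp := measurePreserving_swapCoords (ι := ι) ν s
    conv_rhs => rw [← hmp.map_eq]
    exact (integral_map hmp.measurable.aemeasurable hFm.aestronglyMeasurable).symm
  have hmain : 2 ^ Fintype.card ι * ∫ z, F z ∂(Measure.pi fun _ : ι => ν.prod ν)
      ≤ 2 ^ Fintype.card ι * (K * 2 ^ p *
        (ρ ^ (p / 2 - 1) * (∑ i, a i) * ∫ x, ‖x‖ ^ p ∂ν)) := by
    calc _ = ∑ s : ι → Bool, ∫ z, F (swapCoords s z) ∂(Measure.pi fun _ : ι => ν.prod ν) := by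
          simp [hs]
      _ = ∫ z, ∑ s : ι → Bool, F (swapCoords s z) ∂(Measure.pi fun _ : ι => ν.prod ν) :=
          (integral_finsetSum _ fun s _ =>
            (measurePreserving_swapCoords ν s).integrable_comp_of_integrable hFi).symm
      _ ≤ ∫ z, R z ∂(Measure.pi fun _ : ι => ν.prod ν) :=
          integral_mono (integrable_finsetSum _ fun s _ =>
            (measurePreserving_swapCoords ν s).integrable_comp_of_integrable hFi) hR hpt
      _ = 2 ^ Fintype.card ι * K * (ρ ^ (p / 2 - 1) * ∑ i, a i *
            ∫ z : ι → E × E, ‖(z i).1 - (z i).2‖ ^ p ∂(Measure.pi fun _ : ι => ν.prod ν)) := by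
          simp only [R]
          rw [integral_const_mul, integral_const_mul,
            integral_finsetSum _ fun i _ => (hη i).const_mul (a i)]
          simp_rw [integral_const_mul]
      _ ≤ 2 ^ Fintype.card ι * K * (ρ ^ (p / 2 - 1) * ∑ i, a i *
            (2 ^ p * ∫ x, ‖x‖ ^ p ∂ν)) := by
          have : 0 ≤ K := by positivity
          gcongr with i
          · exact ha0 i
          · exact hηi i
      _ = _ := by rw [← Finset.sum_mul]; ring
  exact le_of_mul_le_mul_left hmain (by positivity)

/-! ### Deviation above the mean -/

/-- Upper deviation of `Z` above its mean, bounded through an independent copy of `Z`. Jensen's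
inequality in the second variable removes the copy, so the centering is the exact mean. -/
theorem measureReal_integral_add_le {Ω : Type*} [MeasurableSpace Ω] {P : Measure Ω}
    [IsProbabilityMeasure P] {Z : Ω → ℝ} (hZ : Integrable Z P) {p : ℝ} (hp : 1 ≤ p)
    (hF : Integrable (fun z : Ω × Ω => |Z z.1 - Z z.2| ^ p) (P.prod P)) {t : ℝ} (ht : 0 < t) :
    P.real {ω | ∫ ω', Z ω' ∂P + t ≤ Z ω}
      ≤ (∫ z : Ω × Ω, |Z z.1 - Z z.2| ^ p ∂(P.prod P)) / t ^ p := by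
  set g : Ω → ℝ := fun ω => ∫ ω', |Z ω - Z ω'| ^ p ∂P
  have hae : ∀ᵐ ω ∂P, ω ∈ {ω | ∫ ω', Z ω' ∂P + t ≤ Z ω} → ω ∈ {ω | t ^ p ≤ g ω} := by
    filter_upwards [hF.prod_right_ae] with ω hω h
    have hi : Integrable (fun ω' => |Z ω - Z ω'|) P := ((integrable_const _).sub hZ).abs
    have h1 : t ≤ ∫ ω', |Z ω - Z ω'| ∂P := by
      calc t ≤ ∫ ω', (Z ω - Z ω') ∂P := by
            rw [integral_sub (integrable_const _) hZ]; simp at h ⊢; linarith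
        _ ≤ _ := integral_mono ((integrable_const _).sub hZ) hi fun ω' => le_abs_self _
    refine (Real.rpow_le_rpow ht.le h1 (by linarith)).trans ?_
    exact (convexOn_rpow hp).map_integral_le
      (continuousOn_id.rpow_const fun x _ => Or.inr (by linarith)) isClosed_Ici
      (ae_of_all _ fun ω' => Set.mem_Ici.2 (abs_nonneg _)) hi hω
  have h2 : P.real {ω | ∫ ω', Z ω' ∂P + t ≤ Z ω} ≤ P.real {ω | t ^ p ≤ g ω} :=
    ENNReal.toReal_mono (measure_ne_top _ _) (measure_mono_ae hae)
  have h3 := mul_meas_ge_le_integral_of_nonneg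
    (ae_of_all P fun ω => (integral_nonneg fun ω' => Real.rpow_nonneg (abs_nonneg _) _ : 0 ≤ g ω))
    hF.integral_prod_left (t ^ p)
  rw [integral_prod _ hF, le_div_iff₀ (Real.rpow_pos_of_pos ht p), mul_comm]
  exact (mul_le_mul_of_nonneg_left h2 (by positivity)).trans h3

/-! ### Nonnegative definite matrices acting on stacked vectors -/

/-- The linear map `v ↦ B (v_1, …, v_N)` on `N`-tuples of vectors of `ℝ^d`, with values in `ℝ^{Nd}`
with its Euclidean norm. The domain carries the sup norm of a product; only its topology
matters. -/
noncomputable def blockMap {N d : ℕ} (B : Matrix (Fin N × Fin d) (Fin N × Fin d) ℝ) :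
    (Fin N → EuclideanSpace ℝ (Fin d)) →L[ℝ] EuclideanSpace ℝ (Fin N × Fin d) :=
  LinearMap.toContinuousLinearMap
    { toFun := fun v => WithLp.toLp 2 (B *ᵥ stackVec v)
      map_add' := fun v w => by
        rw [← WithLp.toLp_add, ← Matrix.mulVec_add]; rfl
      map_smul' := fun c v => by
        rw [RingHom.id_apply, ← WithLp.toLp_smul, ← Matrix.mulVec_smul]; rfl }

/-- The `i`-th block of `Bᵀ u`. These blocks form the adjoint of `blockMap B` for the `ℓ²` product
structure on `N`-tuples, which is not the norm that the domain of `blockMap B` carries; hence the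
explicit formula in place of `ContinuousLinearMap.adjoint`. -/
def blockAdjoint {N d : ℕ} (B : Matrix (Fin N × Fin d) (Fin N × Fin d) ℝ)
    (u : EuclideanSpace ℝ (Fin N × Fin d)) (i : Fin N) : EuclideanSpace ℝ (Fin d) :=
  WithLp.toLp 2 fun j => (Bᵀ *ᵥ u.ofLp) (i, j)

section
variable {N d : ℕ} (B : Matrix (Fin N × Fin d) (Fin N × Fin d) ℝ)

theorem ofLp_blockMap (v : Fin N → EuclideanSpace ℝ (Fin d)) :
    (blockMap B v).ofLp = B *ᵥ stackVec v := rfl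

theorem inner_blockMap (u : EuclideanSpace ℝ (Fin N × Fin d))
    (v : Fin N → EuclideanSpace ℝ (Fin d)) :
    inner ℝ u (blockMap B v) = ∑ i, inner ℝ (blockAdjoint B u i) (v i) := by
  have h1 : inner ℝ u (blockMap B v) = (Bᵀ *ᵥ u.ofLp) ⬝ᵥ stackVec v := by
    rw [EuclideanSpace.inner_eq_star_dotProduct, ofLp_blockMap, star_trivial, dotProduct_comm,
      Matrix.dotProduct_mulVec, ← Matrix.mulVec_transpose]
  rw [h1, dotProduct, Fintype.sum_prod_type]
  refine Finset.sum_congr rfl fun i _ => ?_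
  simp [PiLp.inner_apply, blockAdjoint, stackVec, mul_comm]

theorem norm_blockMap_sq (v : Fin N → EuclideanSpace ℝ (Fin d)) :
    ‖blockMap B v‖ ^ 2 = stackVec v ⬝ᵥ (Bᵀ * B) *ᵥ stackVec v := by
  rw [← real_inner_self_eq_norm_sq, EuclideanSpace.inner_eq_star_dotProduct, ofLp_blockMap,
    star_trivial, ← Matrix.mulVec_mulVec, Matrix.dotProduct_mulVec _ Bᵀ, Matrix.vecMul_transpose]

theorem norm_blockAdjoint_sq_le (u : EuclideanSpace ℝ (Fin N × Fin d)) (i : Fin N) :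
    ‖blockAdjoint B u i‖ ^ 2 ≤ (∑ j, (Bᵀ * B) (i, j) (i, j)) * ‖u‖ ^ 2 := by
  rw [EuclideanSpace.real_norm_sq_eq, EuclideanSpace.real_norm_sq_eq, Finset.sum_mul]
  refine Finset.sum_le_sum fun j _ => ?_
  refine (Finset.sum_mul_sq_le_sq_mul_sq Finset.univ _ _).trans_eq ?_
  simp [Matrix.mul_apply, sq]

theorem sum_norm_blockAdjoint_sq (u : EuclideanSpace ℝ (Fin N × Fin d)) :
    ∑ i, ‖blockAdjoint B u i‖ ^ 2 = ‖Matrix.toEuclideanCLM (𝕜 := ℝ) Bᵀ u‖ ^ 2 := by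
  simp_rw [EuclideanSpace.real_norm_sq_eq]
  rw [Fintype.sum_prod_type]
  rfl

theorem specNorm_transpose_mul_self :
    specNorm (Bᵀ * B) = ‖Matrix.toEuclideanCLM (𝕜 := ℝ) Bᵀ‖ ^ 2 := by
  have h : Bᵀ = star B := by
    rw [Matrix.star_eq_conjTranspose, Matrix.conjTranspose_eq_transpose_of_trivial]
  have h1 := ContinuousLinearMap.norm_adjoint_comp_self (Matrix.toEuclideanCLM (𝕜 := ℝ) B)
  have h2 := ContinuousLinearMap.adjoint.norm_map (Matrix.toEuclideanCLM (𝕜 := ℝ) B)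
  rw [← ContinuousLinearMap.star_eq_adjoint, ← map_star] at h1 h2
  rw [specNorm, h, map_mul, h2, sq]
  exact h1

theorem sum_norm_blockAdjoint_sq_le (u : EuclideanSpace ℝ (Fin N × Fin d)) :
    ∑ i, ‖blockAdjoint B u i‖ ^ 2 ≤ specNorm (Bᵀ * B) * ‖u‖ ^ 2 := by
  rw [sum_norm_blockAdjoint_sq, specNorm_transpose_mul_self, ← mul_pow]
  exact pow_le_pow_left₀ (norm_nonneg _) (ContinuousLinearMap.le_opNorm _ _) 2

theorem sum_diag_blocks (A : Matrix (Fin N × Fin d) (Fin N × Fin d) ℝ) :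
    ∑ i, ∑ j, A (i, j) (i, j) = A.trace := by
  rw [Matrix.trace, Fintype.sum_prod_type]; rfl

theorem diag_transpose_mul_self_nonneg (q : Fin N × Fin d) : 0 ≤ (Bᵀ * B) q q := by
  rw [Matrix.mul_apply]
  exact Finset.sum_nonneg fun r _ => mul_self_nonneg _

theorem specNorm_le_trace : specNorm (Bᵀ * B) ≤ (Bᵀ * B).trace := by
  have hT : 0 ≤ (Bᵀ * B).trace := Finset.sum_nonneg fun q _ => diag_transpose_mul_self_nonneg B q
  rw [specNorm_transpose_mul_self, ← Real.sq_sqrt hT]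
  refine pow_le_pow_left₀ (norm_nonneg _)
    (ContinuousLinearMap.opNorm_le_bound _ (Real.sqrt_nonneg _) fun u => ?_) 2
  refine (sq_le_sq₀ (norm_nonneg _) (by positivity)).1 ?_
  rw [mul_pow, Real.sq_sqrt hT, ← sum_norm_blockAdjoint_sq, ← sum_diag_blocks, Finset.sum_mul]
  exact Finset.sum_le_sum fun i _ => norm_blockAdjoint_sq_le B u i

/-- A diagonal block of a nonnegative definite matrix is bounded, as a quadratic form, by its trace. -/
theorem block_quadratic_le (i : Fin N) (w : Fin d → ℝ) :
    ∑ j, ∑ k, (Bᵀ * B) (i, j) (i, k) * (w j * w k)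
      ≤ (∑ j, (Bᵀ * B) (i, j) (i, j)) * ∑ j, w j ^ 2 := by
  have h1 : ∑ j, ∑ k, (Bᵀ * B) (i, j) (i, k) * (w j * w k)
      = ∑ r, (∑ j, B r (i, j) * w j) ^ 2 := by
    simp_rw [Matrix.mul_apply, Matrix.transpose_apply, sq, Finset.sum_mul_sum, Finset.sum_mul]
    rw [Finset.sum_comm_cycle]
    refine Finset.sum_congr rfl fun r _ => ?_
    exact Finset.sum_congr rfl fun j _ => Finset.sum_congr rfl fun k _ => by ring
  have h2 : ∑ j, (Bᵀ * B) (i, j) (i, j) = ∑ r, ∑ j, B r (i, j) ^ 2 := by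
    rw [Finset.sum_comm]
    simp [Matrix.mul_apply, sq]
  rw [h1, h2, Finset.sum_mul]
  exact Finset.sum_le_sum fun r _ => Finset.sum_mul_sq_le_sq_mul_sq _ _ _

end

theorem specNorm_pos {n : Type*} [Fintype n] [DecidableEq n] {A : Matrix n n ℝ} (hA : A ≠ 0) :
    0 < specNorm A := by
  rw [specNorm, norm_pos_iff]
  exact (map_ne_zero_iff _ (Matrix.toEuclideanCLM (𝕜 := ℝ) (n := n)).injective).2 hA

open scoped MatrixOrder Matrix.Norms.L2Operator in
theorem exists_transpose_mul_self {n : Type*} [Fintype n] [DecidableEq n] {A : Matrix n n ℝ}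
    (hA : A.PosSemidef) : ∃ B : Matrix n n ℝ, A = Bᵀ * B := by
  obtain ⟨B, hB⟩ := CStarAlgebra.nonneg_iff_eq_star_mul_self.1 hA.nonneg
  exact ⟨B, by
    rwa [Matrix.star_eq_conjTranspose, Matrix.conjTranspose_eq_transpose_of_trivial] at hB⟩

/-! ### Second moments and deviations of the quadratic form -/

section
variable {Ω : Type*} [MeasurableSpace Ω] {μ : Measure Ω}

theorem memLp_of_integrable_norm_rpow {E : Type*} [NormedAddCommGroup E] [MeasurableSpace E]
    [BorelSpace E] [SecondCountableTopology E] {X : Ω → E} {p : ℝ}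
    (hp : 0 < p) (hX : Measurable X) (h : Integrable (fun ω => ‖X ω‖ ^ p) μ) :
    MemLp X (ENNReal.ofReal p) μ := by
  rw [← integrable_norm_rpow_iff hX.aestronglyMeasurable (by simpa using hp) ENNReal.ofReal_ne_top,
    ENNReal.toReal_ofReal hp.le]
  exact h

theorem rpow_half_integral_norm_sq_le [IsProbabilityMeasure μ] {E : Type*} [NormedAddCommGroup E]
    {X : Ω → E} {p : ℝ} (hp : 2 ≤ p) (h2 : Integrable (fun ω => ‖X ω‖ ^ 2) μ)
    (h : Integrable (fun ω => ‖X ω‖ ^ p) μ) :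
    (∫ ω, ‖X ω‖ ^ 2 ∂μ) ^ (p / 2) ≤ ∫ ω, ‖X ω‖ ^ p ∂μ := by
  have e : (fun ω => (‖X ω‖ ^ 2) ^ (p / 2)) = fun ω => ‖X ω‖ ^ p := by
    funext ω
    rw [← Real.rpow_natCast, ← Real.rpow_mul (norm_nonneg _)]
    congr 1; push_cast; ring
  rw [← e]
  refine (convexOn_rpow (by linarith : 1 ≤ p / 2)).map_integral_le
    (continuousOn_id.rpow_const fun x _ => Or.inr (by linarith)) isClosed_Ici
    (ae_of_all _ fun ω' => Set.mem_Ici.2 (sq_nonneg _)) h2 ?_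
  rw [← e] at h
  exact h

theorem integral_le_sqrt_integral_sq [IsProbabilityMeasure μ] {Z : Ω → ℝ} (hZ : MemLp Z 2 μ) :
    ∫ ω, Z ω ∂μ ≤ √(∫ ω, Z ω ^ 2 ∂μ) := by
  refine Real.le_sqrt_of_sq_le ?_
  have h := variance_eq_sub hZ
  have h0 := variance_nonneg Z μ
  simp only [Pi.pow_apply] at h
  linarith

variable {N d : ℕ} {X : Ω → EuclideanSpace ℝ (Fin d)}

theorem memLp_coord (hX : MemLp X 2 μ) (j : Fin d) : MemLp (fun ω => X ω j) 2 μ :=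
  hX.mono ((EuclideanSpace.proj (𝕜 := ℝ) j).continuous.comp_aestronglyMeasurable hX.1)
    (ae_of_all _ fun ω => PiLp.norm_apply_le (X ω) j)

theorem integral_coord (hX : Integrable X μ) (h0 : ∫ ω, X ω ∂μ = 0) (j : Fin d) :
    ∫ ω, X ω j ∂μ = 0 := by
  have := (EuclideanSpace.proj (𝕜 := ℝ) j).integral_comp_comm hX
  rw [h0] at this
  simpa using this

theorem covarMat_apply [IsProbabilityMeasure μ]
    (hX : MemLp X 2 μ) (h0 : ∫ ω, X ω ∂μ = 0) (j k : Fin d) :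
    covarMat μ X j k = ∫ ω, X ω j * X ω k ∂μ := by
  have hi := integral_coord (hX.integrable one_le_two) h0 j
  rw [covarMat, Matrix.of_apply, covariance_eq_sub (memLp_coord hX j) (memLp_coord hX k), hi]
  simp

theorem trace_mul_one_kronecker (A : Matrix (Fin N × Fin d) (Fin N × Fin d) ℝ)
    (Φ : Matrix (Fin d) (Fin d) ℝ) :
    (A * ((1 : Matrix (Fin N) (Fin N) ℝ) ⊗ₖ Φ)).trace
      = ∑ i, ∑ j, ∑ k, A (i, j) (i, k) * Φ k j := by
  simp only [Matrix.trace, Matrix.diag_apply, Matrix.mul_apply, Fintype.sum_prod_type,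
    Matrix.kronecker_apply, Matrix.one_apply]
  refine Finset.sum_congr rfl fun i _ => Finset.sum_congr rfl fun j _ => ?_
  rw [Finset.sum_eq_single i]
  · simp
  · intro b _ hb; simp [hb]
  · simp

/-- With the normalisation `Tr (A (I ⊗ Φ)) = δ² Tr A` this says `δ² ≤ 𝔼 ‖X‖²`. -/
theorem trace_mul_one_kronecker_covarMat_le [IsProbabilityMeasure μ]
    (B : Matrix (Fin N × Fin d) (Fin N × Fin d) ℝ)
    (hX : MemLp X 2 μ) (h0 : ∫ ω, X ω ∂μ = 0) :
    ((Bᵀ * B) * ((1 : Matrix (Fin N) (Fin N) ℝ) ⊗ₖ covarMat μ X)).trace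
      ≤ (Bᵀ * B).trace * ∫ ω, ‖X ω‖ ^ 2 ∂μ := by
  have hint (j k : Fin d) : Integrable (fun ω => X ω j * X ω k) μ :=
    (memLp_coord hX j).integrable_mul (memLp_coord hX k)
  have h2 : Integrable (fun ω => ‖X ω‖ ^ 2) μ := hX.integrable_norm_pow two_ne_zero
  rw [trace_mul_one_kronecker, ← sum_diag_blocks, Finset.sum_mul]
  refine Finset.sum_le_sum fun i _ => ?_
  have e : ∑ j, ∑ k, (Bᵀ * B) (i, j) (i, k) * covarMat μ X k j
      = ∫ ω, ∑ j, ∑ k, (Bᵀ * B) (i, j) (i, k) * (X ω j * X ω k) ∂μ := by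
    rw [integral_finsetSum _ fun j _ => integrable_finsetSum _ fun k _ => (hint j k).const_mul _]
    refine Finset.sum_congr rfl fun j _ => ?_
    rw [integral_finsetSum _ fun k _ => (hint j k).const_mul _]
    refine Finset.sum_congr rfl fun k _ => ?_
    rw [integral_const_mul, covarMat_apply hX h0]
    simp_rw [mul_comm (X _ k)]
  rw [e, ← integral_const_mul]
  refine integral_mono (integrable_finsetSum _ fun j _ => integrable_finsetSum _ fun k _ =>
    (hint j k).const_mul _) (h2.const_mul _) fun ω => ?_
  have := block_quadratic_le B i (fun j => X ω j)
  simpa only [EuclideanSpace.real_norm_sq_eq] using this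

theorem integral_quadratic_form [IsProbabilityMeasure μ] [NeZero N]
    (A : Matrix (Fin N × Fin d) (Fin N × Fin d) ℝ)
    {ε : Fin N → Ω → EuclideanSpace ℝ (Fin d)} (hind : iIndepFun ε μ)
    (hid : ∀ i, IdentDistrib (ε i) (ε 0) μ μ) (h2 : MemLp (ε 0) 2 μ)
    (h0 : ∫ ω, ε 0 ω ∂μ = 0) :
    ∫ ω, stackVec (fun i => ε i ω) ⬝ᵥ A *ᵥ stackVec (fun i => ε i ω) ∂μ
      = (A * ((1 : Matrix (Fin N) (Fin N) ℝ) ⊗ₖ covarMat μ (ε 0))).trace := by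
  have h2i (i) : MemLp (ε i) 2 μ := (hid i).symm.memLp_snd h2
  have h0i (i) : ∫ ω, ε i ω ∂μ = 0 := by rw [(hid i).integral_eq, h0]
  have hint (i j k l) : Integrable (fun ω => ε i ω j * ε k ω l) μ :=
    (memLp_coord (h2i i) j).integrable_mul (memLp_coord (h2i k) l)
  have hmean (i k : Fin N) (j l : Fin d) : ∫ ω, ε i ω j * ε k ω l ∂μ
      = if i = k then covarMat μ (ε 0) l j else 0 := by
    split_ifs with h
    · subst h
      rw [covarMat_apply h2 h0]
      have hm : Measurable fun v : EuclideanSpace ℝ (Fin d) => v l * v j := by fun_prop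
      have := ((hid i).comp hm).integral_eq
      simpa only [Function.comp_def, mul_comm] using this
    · have hi : IndepFun (fun ω => ε i ω j) (fun ω => ε k ω l) μ :=
        (hind.indepFun h).comp (φ := fun v : EuclideanSpace ℝ (Fin d) => v j)
          (ψ := fun v : EuclideanSpace ℝ (Fin d) => v l) (by fun_prop) (by fun_prop)
      have hc := hi.covariance_eq_zero (memLp_coord (h2i i) j) (memLp_coord (h2i k) l)
      rw [covariance_eq_sub (memLp_coord (h2i i) j) (memLp_coord (h2i k) l),
        integral_coord ((h2i i).integrable one_le_two) (h0i i) j, zero_mul, sub_zero] at hc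
      exact hc
  have hint' (q r : Fin N × Fin d) :
      Integrable (fun ω => A q r * (ε q.1 ω q.2 * ε r.1 ω r.2)) μ :=
    (hint _ _ _ _).const_mul _
  calc _ = ∫ ω, ∑ q : Fin N × Fin d, ∑ r : Fin N × Fin d,
          A q r * (ε q.1 ω q.2 * ε r.1 ω r.2) ∂μ := by
        refine integral_congr_ae (ae_of_all _ fun ω => ?_)
        simp only [dotProduct, Matrix.mulVec, stackVec, Finset.mul_sum]
        exact Finset.sum_congr rfl fun q _ => Finset.sum_congr rfl fun r _ => by ring
    _ = ∑ q : Fin N × Fin d, ∑ r : Fin N × Fin d,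
          A q r * if q.1 = r.1 then covarMat μ (ε 0) r.2 q.2 else 0 := by
        rw [integral_finsetSum _ fun q _ => integrable_finsetSum _ fun r _ => hint' q r]
        refine Finset.sum_congr rfl fun q _ => ?_
        rw [integral_finsetSum _ fun r _ => hint' q r]
        refine Finset.sum_congr rfl fun r _ => ?_
        rw [integral_const_mul, hmean]
    _ = _ := by
        simp only [Matrix.trace, Matrix.diag_apply, Matrix.mul_apply]
        refine Finset.sum_congr rfl fun q _ => Finset.sum_congr rfl fun r _ => ?_
        by_cases h : q.1 = r.1
        · rw [if_pos h, Matrix.kronecker_apply, h, Matrix.one_apply_eq, one_mul]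
        · rw [if_neg h, Matrix.kronecker_apply, Matrix.one_apply_ne (Ne.symm h), zero_mul]

/-- Deviation of `‖B ε‖` above `√(𝔼 ‖B ε‖²)`, where `𝔼 ‖B ε‖² = Tr (BᵀB (I ⊗ Φ))`. Only the spectral
norm of `BᵀB` enters with the power `p / 2 - 1`; its trace enters linearly. -/
theorem measureReal_norm_blockMap_ge_le [IsProbabilityMeasure μ] [NeZero N] {p : ℝ} (hp : 2 ≤ p)
    (B : Matrix (Fin N × Fin d) (Fin N × Fin d) ℝ)
    {ε : Fin N → Ω → EuclideanSpace ℝ (Fin d)} (hε : ∀ i, Measurable (ε i))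
    (hind : iIndepFun ε μ) (hid : ∀ i, IdentDistrib (ε i) (ε 0) μ μ)
    (h0 : ∫ ω, ε 0 ω ∂μ = 0) (hM : Integrable (fun ω => ‖ε 0 ω‖ ^ p) μ) {t : ℝ} (ht : 0 < t) :
    μ.real {ω | √((Bᵀ * B) * ((1 : Matrix (Fin N) (Fin N) ℝ) ⊗ₖ covarMat μ (ε 0))).trace + t
        ≤ ‖blockMap B fun i => ε i ω‖}
      ≤ 2 * Real.exp (1 / 2) * p ^ p * 2 ^ p *
        (specNorm (Bᵀ * B) ^ (p / 2 - 1) * (Bᵀ * B).trace * ∫ ω, ‖ε 0 ω‖ ^ p ∂μ) / t ^ p := by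
  have h2 : MemLp (ε 0) 2 μ := (memLp_of_integrable_norm_rpow (by linarith) (hε 0) hM).mono_exponent
    (by rw [ENNReal.le_ofReal_iff_toReal_le (by simp) (by linarith)]; simpa using hp)
  have h2i (i) : MemLp (ε i) 2 μ := (hid i).symm.memLp_snd h2
  have hmeas : Measurable fun ω i => ε i ω := measurable_pi_lambda _ hε
  set ν := μ.map (ε 0)
  have : IsProbabilityMeasure ν := Measure.isProbabilityMeasure_map (hε 0).aemeasurable
  have hlaw : μ.map (fun ω i => ε i ω) = Measure.pi fun _ => ν := by
    rw [(iIndepFun_iff_map_fun_eq_pi_map fun i => (hε i).aemeasurable).1 hind]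
    congr 1
    funext i
    exact (hid i).map_eq
  have hnp : Measurable fun x : EuclideanSpace ℝ (Fin d) => ‖x‖ ^ p := by fun_prop
  have hν : Integrable (fun x => ‖x‖ ^ p) ν :=
    (integrable_map_measure hnp.aestronglyMeasurable (hε 0).aemeasurable).2 hM
  have hνM : ∫ x, ‖x‖ ^ p ∂ν = ∫ ω, ‖ε 0 ω‖ ^ p ∂μ :=
    integral_map (hε 0).aemeasurable hnp.aestronglyMeasurable
  obtain ⟨hF, hFle⟩ := integral_abs_norm_sub_rpow_le (blockMap B) (blockAdjoint B) hp
    (inner_blockMap B) (norm_blockAdjoint_sq_le B) (sum_norm_blockAdjoint_sq_le B)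
    (fun i => Finset.sum_nonneg fun j _ => diag_transpose_mul_self_nonneg B _)
    (norm_nonneg _) ν hν
  rw [sum_diag_blocks, hνM] at hFle
  set Z : (Fin N → EuclideanSpace ℝ (Fin d)) → ℝ := fun v => ‖blockMap B v‖
  have hZm : Measurable Z := (blockMap B).continuous.norm.measurable
  have hZ2 : MemLp (fun ω => Z fun i => ε i ω) 2 μ := by
    have : MemLp (fun ω => fun i => ε i ω) 2 μ := memLp_pi_iff.2 h2i
    exact ((blockMap B).comp_memLp' this).norm
  have hZi : Integrable Z (Measure.pi fun _ => ν) := by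
    rw [← hlaw]
    exact (integrable_map_measure hZm.aestronglyMeasurable hmeas.aemeasurable).2
      (hZ2.integrable one_le_two)
  have hEZ : ∫ v, Z v ∂(Measure.pi fun _ => ν)
      ≤ √((Bᵀ * B) * ((1 : Matrix (Fin N) (Fin N) ℝ) ⊗ₖ covarMat μ (ε 0))).trace := by
    rw [← hlaw, integral_map hmeas.aemeasurable hZm.aestronglyMeasurable,
      ← integral_quadratic_form _ hind hid h2 h0]
    refine (integral_le_sqrt_integral_sq hZ2).trans_eq ?_
    simp only [Z, norm_blockMap_sq]
  have key := measureReal_integral_add_le hZi (by linarith : 1 ≤ p) hF ht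
  refine le_trans ?_ (key.trans (div_le_div_of_nonneg_right hFle (by positivity)))
  rw [← hlaw, map_measureReal_apply hmeas (measurableSet_le measurable_const hZm), hlaw]
  refine measureReal_mono fun ω hω => ?_
  simp only [Set.mem_preimage, Set.mem_ofPred_eq] at hω ⊢
  linarith

end

/-! ### The two tail bounds -/

/-- The tail bound at deviation `δ * √(ρ * x / 6)`, brought to the form of the final estimate. -/
theorem mul_rpow_div_sqrt_rpow {K ρ T M δ x p : ℝ} (hρ : 0 < ρ) (hδ : 0 < δ) (hx : 0 < x) :
    K * (ρ ^ (p / 2 - 1) * T * M) / (δ * √(ρ * x / 6)) ^ p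
      = K * 6 ^ (p / 2) * (M * T / (δ ^ p * ρ * x ^ (p / 2))) := by
  have h1 : (δ * √(ρ * x / 6)) ^ p = δ ^ p * (ρ ^ (p / 2) * x ^ (p / 2) / 6 ^ (p / 2)) := by
    rw [Real.mul_rpow hδ.le (Real.sqrt_nonneg _), Real.sqrt_eq_rpow,
      ← Real.rpow_mul (by positivity), one_div_mul_eq_div,
      Real.div_rpow (by positivity) (by norm_num), Real.mul_rpow hρ.le hx.le]
  have h2 : ρ ^ (p / 2) = ρ ^ (p / 2 - 1) * ρ := by
    rw [Real.rpow_sub_one hρ.ne', div_mul_cancel₀ _ hρ.ne']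
  have : 0 < ρ ^ (p / 2 - 1) := Real.rpow_pos_of_pos hρ _
  have : 0 < x ^ (p / 2) := Real.rpow_pos_of_pos hx _
  have : 0 < δ ^ p := Real.rpow_pos_of_pos hδ _
  rw [h1, h2]
  field_simp

theorem sqrt_add_le_norm_of_le {δ T y S Q : ℝ} (hδ : 0 ≤ δ) (hT : 0 ≤ T) (hy : 0 ≤ y) (hS : 0 ≤ S)
    (hSQ : S ^ 2 = Q) (h : δ ^ 2 * (T + 2 * √(T * y) + y) ≤ Q) :
    √(δ ^ 2 * T) + δ * √y ≤ S := by
  rw [Real.sqrt_mul (sq_nonneg δ), Real.sqrt_sq hδ]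
  rw [Real.sqrt_mul hT] at h
  refine (sq_le_sq₀ (by positivity) hS).1 ?_
  rw [hSQ]
  refine le_trans (le_of_eq ?_) h
  linear_combination δ ^ 2 * Real.sq_sqrt hT + δ ^ 2 * Real.sq_sqrt hy

theorem proposition4p3 (p : ℝ) (hp : 2 ≤ p) :
    ∃ C : ℝ, 0 < C ∧
      ∀ (N d : ℕ) [NeZero N]
        (A : Matrix (Fin N × Fin d) (Fin N × Fin d) ℝ)
        (Ω : Type*) [MeasurableSpace Ω] (μ : Measure Ω) [IsProbabilityMeasure μ]
        (ε : Fin N → Ω → EuclideanSpace ℝ (Fin d)) (δ : ℝ),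
        A ≠ 0 → A.PosSemidef →
        (∀ i, Measurable (ε i)) →
        iIndepFun ε μ →
        (∀ i, IdentDistrib (ε i) (ε 0) μ μ) →
        ∫ ω, ε 0 ω ∂μ = 0 →
        Integrable (fun ω => ‖ε 0 ω‖ ^ p) μ →
        0 < δ →
        (A * ((1 : Matrix (Fin N) (Fin N) ℝ) ⊗ₖ covarMat μ (ε 0))).trace = δ ^ 2 * A.trace →
        ∀ x : ℝ, 0 < x →
          μ.real {ω | δ ^ 2 * A.trace + 2 * δ ^ 2 * √(A.trace * specNorm A * x)
                + δ ^ 2 * specNorm A * x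
              ≤ stackVec (fun i => ε i ω) ⬝ᵥ A *ᵥ stackVec (fun i => ε i ω)}
            ≤ C * ((∫ ω, ‖ε 0 ω‖ ^ p ∂μ) * A.trace / (δ ^ p * specNorm A * x ^ (p / 2))) ∧
          μ.real {ω | δ ^ 2 * A.trace + 2 * δ ^ 2 * √(A.trace * δ * x)
                + δ ^ 2 * A.trace * x
              ≤ stackVec (fun i => ε i ω) ⬝ᵥ A *ᵥ stackVec (fun i => ε i ω)}
            ≤ C * ((∫ ω, ‖ε 0 ω‖ ^ p ∂μ) * A.trace / (δ ^ p * specNorm A * x ^ (p / 2))) := by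
  have hp0 : 0 < p := by linarith
  refine ⟨2 * Real.exp (1 / 2) * p ^ p * 2 ^ p * 6 ^ (p / 2), by positivity, ?_⟩
  intro N d _ A Ω _ μ _ ε δ hA0 hA hε hind hid h0 hM hδ htr x hx
  obtain ⟨B, rfl⟩ := exists_transpose_mul_self hA
  have hρ : 0 < specNorm (Bᵀ * B) := specNorm_pos hA0
  have hρT : specNorm (Bᵀ * B) ≤ (Bᵀ * B).trace := specNorm_le_trace B
  have htail := measureReal_norm_blockMap_ge_le hp B hε hind hid h0 hM
    (t := δ * √(specNorm (Bᵀ * B) * x / 6)) (by positivity)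
  have hB2 (ω : Ω) := norm_blockMap_sq B fun i => ε i ω
  have h2 : MemLp (ε 0) 2 μ := (memLp_of_integrable_norm_rpow hp0 (hε 0) hM).mono_exponent
    (by rw [ENNReal.le_ofReal_iff_toReal_le (by simp) (by linarith)]; simpa using hp)
  have hcov := trace_mul_one_kronecker_covarMat_le (N := N) B h2 h0
  rw [mul_rpow_div_sqrt_rpow hρ hδ hx, htr] at htail
  rw [htr] at hcov
  set ρ := specNorm (Bᵀ * B)
  set T := (Bᵀ * B).trace
  set M := ∫ ω, ‖ε 0 ω‖ ^ p ∂μ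
  have hT : 0 < T := hρ.trans_le hρT
  -- Both events lie in the event of `htail`, except for small `x` in the second one. The factor
  -- `1 / 6` is only needed there.
  have hsub {s : Set Ω} (hs : ∀ ω ∈ s, δ ^ 2 * (T + 2 * √(T * (ρ * x / 6)) + ρ * x / 6)
      ≤ stackVec (fun i => ε i ω) ⬝ᵥ (Bᵀ * B) *ᵥ stackVec (fun i => ε i ω)) :=
    (measureReal_mono (μ := μ) fun ω hω => sqrt_add_le_norm_of_le hδ.le hT.le (by positivity)
      (norm_nonneg _) (hB2 ω) (hs ω hω)).trans htail
  refine ⟨hsub fun ω hω => le_trans ?_ (Set.mem_ofPred_eq ▸ hω), ?_⟩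
  · have e1 : √(T * (ρ * x / 6)) ≤ √(T * ρ * x) := Real.sqrt_le_sqrt (by
      have : 0 < T * ρ * x := by positivity
      linarith)
    have e2 : ρ * x / 6 ≤ ρ * x := by linarith [mul_pos hρ hx]
    calc _ ≤ δ ^ 2 * (T + 2 * √(T * ρ * x) + ρ * x) := by gcongr
      _ = _ := by ring
  rcases le_total (T * x) ρ with hc | hc
  · -- Here `x ≤ 1`, and the bound is at least `1` because `δ ^ p ≤ M` and `ρ ≤ T`.
    refine measureReal_le_one.trans ?_
    have hδM : δ ^ p ≤ M := by
      refine le_trans ?_ (rpow_half_integral_norm_sq_le hp (h2.integrable_norm_pow two_ne_zero) hM)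
      have : δ ^ 2 ≤ ∫ ω, ‖ε 0 ω‖ ^ 2 ∂μ := by
        rw [mul_comm] at hcov
        exact le_of_mul_le_mul_left hcov hT
      calc δ ^ p = (δ ^ 2) ^ (p / 2) := by
            rw [← Real.rpow_natCast, ← Real.rpow_mul hδ.le]; congr 1; push_cast; ring
        _ ≤ _ := Real.rpow_le_rpow (sq_nonneg _) this (by positivity)
    have hx1 : x ≤ 1 := by
      by_contra! h
      nlinarith
    have hxp : x ^ (p / 2) ≤ 1 := Real.rpow_le_one hx.le hx1 (by positivity)
    have hδp : 0 < δ ^ p := Real.rpow_pos_of_pos hδ p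
    have hfrac : 1 ≤ M * T / (δ ^ p * ρ * x ^ (p / 2)) := by
      rw [one_le_div (by positivity)]
      calc δ ^ p * ρ * x ^ (p / 2) ≤ δ ^ p * ρ * 1 := by gcongr
        _ ≤ M * T := by rw [mul_one]; gcongr
    have hK : 1 ≤ 2 * Real.exp (1 / 2) * p ^ p * 2 ^ p * 6 ^ (p / 2) := by
      have k1 : 1 ≤ Real.exp (1 / 2) := Real.one_le_exp (by norm_num)
      have k2 : 1 ≤ p ^ p := Real.one_le_rpow (by linarith) hp0.le
      have k3 : (1 : ℝ) ≤ 2 ^ p := Real.one_le_rpow (by norm_num) hp0.le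
      have k4 : (1 : ℝ) ≤ 6 ^ (p / 2) := Real.one_le_rpow (by norm_num) (by positivity)
      have k5 : 1 ≤ 2 * Real.exp (1 / 2) := by linarith
      exact one_le_mul_of_one_le_of_one_le (one_le_mul_of_one_le_of_one_le
        (one_le_mul_of_one_le_of_one_le k5 k2) k3) k4
    exact one_le_mul_of_one_le_of_one_le hK hfrac
  · refine hsub fun ω hω => le_trans ?_ (Set.mem_ofPred_eq ▸ hω)
    have hTx : 0 < T * x := by positivity
    -- The term `T * x` alone suffices, as `2 * √(1 / 6) + 1 / 6 < 1`; `5 / 12` exceeds `√(1 / 6)`.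
    have e1 : √(T * (ρ * x / 6)) ≤ 5 / 12 * (T * x) := by
      refine Real.sqrt_le_iff.2 ⟨by positivity, ?_⟩
      have := mul_le_mul_of_nonneg_left hc hTx.le
      nlinarith
    have e2 : ρ * x ≤ T * x := mul_le_mul_of_nonneg_right hρT hx.le
    have e3 : 0 ≤ √(T * δ * x) := Real.sqrt_nonneg _
    calc _ ≤ δ ^ 2 * (T + 2 * √(T * δ * x) + T * x) := by
          gcongr ?_ * ?_
          linarith
      _ = _ := by ring
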